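/- Let $U\subset\mathbb R^N$ be a bounded connected open set with smooth boundary, let $\Omega=\overline U$, and let $1<q<\infty$, $p=q/(q-1)$. Let $W^{1,q}(\Omega)$ be the space of functions in $L^q(\Omega)$ whose distributional gradient (in $U$) belongs to $L^q(\Omega;\mathbb R^N)$, and let $\dot W^{1,q}(\Omega)=W^{1,q}(\Omega)/\sim$, where $u\sim v$ if and only if $u-v$ is a.e. equal to a constant, with the norm $\|u\|_{\dot W^{1,q}(\Omega)}=\left(\int_\Omega|\nabla u|^q\,dx\right)^{1/q}$. Let $\dot W^{-1,p}(\Omega)$ be the dual space of $\dot W^{1,q}(\Omega)$, with the dual norm $$\|T\|_{\dot W^{-1,p}(\Omega)}=\sup\left\{\langle T,\varphi\rangle\,:\,\varphi\in\dot W^{1,q}(\Omega),\ \|\varphi\|_{\dot W^{1,q}(\Omega)}=1\right\}.$$ For $T\in\dot W^{-1,p}(\Omega)$ and $V\in L^p(\Omega;\mathbb R^N)$ we say that $-\mathrm{div}\,V=T$ in $\Omega$ and $V\cdot\nu_\Omega=0$ on $\partial\Omega$ if $$\int_\Omega\nabla\varphi\cdot V\,dx=\langle T,\varphi\rangle\qquad\text{for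 every }\varphi\in C^1(\Omega),$$ where $C^1(\Omega)$ is the space of functions that are continuously differentiable on the compact set $\Omega$, up to the boundary, and $\langle T,\varphi\rangle$ is the value of $T$ at the class of $\varphi$. Then for every $T\in\dot W^{-1,p}(\Omega)$ $$\|T\|_{\dot W^{-1,p}(\Omega)}=\min_{V\in L^p(\Omega;\mathbb R^N)}\Big\{\|V\|_{L^p(\Omega)}\,:\,-\mathrm{div}\,V=T,\quad V\cdot\nu_\Omega=0\Big\};$$ in particular such vector fields $V$ exist and the minimum is attained. (If $N=0$, the supremum of the empty set is read as $0$.) -/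

import Mathlib

open MeasureTheory Set Topology
open scoped ENNReal ContDiff

noncomputable section

/-- A bounded, connected (hence nonempty), open subset of `ℝ^N` with smooth boundary: near each
boundary point `x₀` the set is `{ρ < 0}` for a smooth `ρ` with `∇ρ(x₀) ≠ 0`. -/
structure SmoothDomain (N : ℕ) where
  carrier : Set (EuclideanSpace ℝ (Fin N))
  isOpen : IsOpen carrier
  bounded : Bornology.IsBounded carrier
  connected : IsConnected carrier
  smooth_boundary : ∀ x₀ ∈ frontier carrier,
    ∃ (W : Set (EuclideanSpace ℝ (Fin N))) (ρ : EuclideanSpace ℝ (Fin N) → ℝ),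
      IsOpen W ∧ x₀ ∈ W ∧ ContDiffOn ℝ ∞ ρ W ∧ fderiv ℝ ρ x₀ ≠ 0 ∧
      ∀ x ∈ W, x ∈ carrier ↔ ρ x < 0

namespace SmoothDomain

variable {N : ℕ} (Ω : SmoothDomain N)

/-- Lebesgue measure on the domain. -/
abbrev vol : Measure (EuclideanSpace ℝ (Fin N)) := volume.restrict Ω.carrier

instance : IsFiniteMeasure Ω.vol :=
  ⟨by rw [Measure.restrict_apply_univ]; exact Ω.bounded.measure_lt_top⟩

/-- `g` is the distributional gradient of `u` in the open set `Ω`: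
`∫ u ∂_v η = - ∫ (g · v) η` for all `η ∈ C_c^∞(Ω)` and all vectors `v`. -/
def HasWeakGradient (u : EuclideanSpace ℝ (Fin N) → ℝ)
    (g : EuclideanSpace ℝ (Fin N) → EuclideanSpace ℝ (Fin N)) : Prop :=
  ∀ η : EuclideanSpace ℝ (Fin N) → ℝ, ContDiff ℝ ∞ η → HasCompactSupport η →
    tsupport η ⊆ Ω.carrier → ∀ v : EuclideanSpace ℝ (Fin N),
      ∫ x in Ω.carrier, u x * fderiv ℝ η x v = -∫ x in Ω.carrier, inner ℝ (g x) v * η x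

variable {Ω}

theorem HasWeakGradient.congr {u u' : EuclideanSpace ℝ (Fin N) → ℝ}
    {g g' : EuclideanSpace ℝ (Fin N) → EuclideanSpace ℝ (Fin N)}
    (h : Ω.HasWeakGradient u g) (hu : u =ᵐ[Ω.vol] u') (hg : g =ᵐ[Ω.vol] g') :
    Ω.HasWeakGradient u' g' := by
  intro η h1 h2 h3 v
  have e1 : ∫ x in Ω.carrier, u' x * fderiv ℝ η x v = ∫ x in Ω.carrier, u x * fderiv ℝ η x v :=
    integral_congr_ae (by filter_upwards [hu] with x hx; rw [hx])
  have e2 : ∫ x in Ω.carrier, inner ℝ (g' x) v * η x = ∫ x in Ω.carrier, inner ℝ (g x) v * η x :=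
    integral_congr_ae (by filter_upwards [hg] with x hx; rw [hx])
  rw [e1, e2]
  exact h η h1 h2 h3 v

theorem integrable_mul_fderiv {u η : EuclideanSpace ℝ (Fin N) → ℝ} (hu : Integrable u Ω.vol)
    (h1 : ContDiff ℝ ∞ η) (h2 : HasCompactSupport η) (v : EuclideanSpace ℝ (Fin N)) :
    Integrable (fun x => u x * fderiv ℝ η x v) Ω.vol := by
  have hc : Continuous (fun x => fderiv ℝ η x v) :=
    (h1.continuous_fderiv (by simp)).clm_apply continuous_const
  obtain ⟨C, hC⟩ := (h2.fderiv_apply (𝕜 := ℝ) v).exists_bound_of_continuous hc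
  exact hu.mul_bdd (c := C) hc.aestronglyMeasurable (Filter.Eventually.of_forall hC)

theorem integrable_inner_mul {g : EuclideanSpace ℝ (Fin N) → EuclideanSpace ℝ (Fin N)}
    {η : EuclideanSpace ℝ (Fin N) → ℝ} (hg : Integrable g Ω.vol)
    (h1 : ContDiff ℝ ∞ η) (h2 : HasCompactSupport η) (v : EuclideanSpace ℝ (Fin N)) :
    Integrable (fun x => inner ℝ (g x) v * η x) Ω.vol := by
  obtain ⟨C, hC⟩ := h2.exists_bound_of_continuous h1.continuous
  exact (hg.inner_const v).mul_bdd (c := C) h1.continuous.aestronglyMeasurable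
    (Filter.Eventually.of_forall hC)

theorem HasWeakGradient.add {u u' : EuclideanSpace ℝ (Fin N) → ℝ}
    {g g' : EuclideanSpace ℝ (Fin N) → EuclideanSpace ℝ (Fin N)}
    (h : Ω.HasWeakGradient u g) (h' : Ω.HasWeakGradient u' g')
    (hu : Integrable u Ω.vol) (hu' : Integrable u' Ω.vol)
    (hg : Integrable g Ω.vol) (hg' : Integrable g' Ω.vol) :
    Ω.HasWeakGradient (u + u') (g + g') := by
  intro η h1 h2 h3 v
  simp only [Pi.add_apply, add_mul, inner_add_left]
  rw [integral_add (integrable_mul_fderiv hu h1 h2 v) (integrable_mul_fderiv hu' h1 h2 v),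
    integral_add (integrable_inner_mul hg h1 h2 v) (integrable_inner_mul hg' h1 h2 v),
    h η h1 h2 h3 v, h' η h1 h2 h3 v, neg_add]

theorem HasWeakGradient.smul {u : EuclideanSpace ℝ (Fin N) → ℝ}
    {g : EuclideanSpace ℝ (Fin N) → EuclideanSpace ℝ (Fin N)}
    (h : Ω.HasWeakGradient u g) (c : ℝ) : Ω.HasWeakGradient (c • u) (c • g) := by
  intro η h1 h2 h3 v
  simp only [Pi.smul_apply, smul_eq_mul, mul_assoc, real_inner_smul_left]
  rw [integral_const_mul, integral_const_mul, h η h1 h2 h3 v, mul_neg]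

theorem HasWeakGradient.unique {u : EuclideanSpace ℝ (Fin N) → ℝ}
    {g g' : EuclideanSpace ℝ (Fin N) → EuclideanSpace ℝ (Fin N)}
    (h : Ω.HasWeakGradient u g) (h' : Ω.HasWeakGradient u g')
    (hg : Integrable g Ω.vol) (hg' : Integrable g' Ω.vol) : g =ᵐ[Ω.vol] g' := by
  have key := Ω.isOpen.ae_eq_zero_of_integral_contDiff_smul_eq_zero (μ := Ω.vol)
    (f := fun x => g x - g' x) ((hg.sub hg').locallyIntegrable.locallyIntegrableOn _) ?_
  · filter_upwards [key, ae_restrict_mem Ω.isOpen.measurableSet] with x hx hxU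
    exact sub_eq_zero.mp (hx hxU)
  · intro η h1 h2 h3
    obtain ⟨C, hC⟩ := h2.exists_bound_of_continuous h1.continuous
    have hint : Integrable (fun x => η x • (g x - g' x)) Ω.vol :=
      (hg.sub hg').bdd_smul C h1.continuous.aestronglyMeasurable (Filter.Eventually.of_forall hC)
    refine ext_inner_left ℝ fun v => ?_
    rw [inner_zero_right, ← integral_inner hint v]
    have e : ∀ x, inner ℝ v (η x • (g x - g' x))
        = inner ℝ (g x) v * η x - inner ℝ (g' x) v * η x := by
      intro x
      rw [real_inner_smul_right, inner_sub_right, real_inner_comm v (g x),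
        real_inner_comm v (g' x)]
      ring
    simp only [e]
    rw [integral_sub (integrable_inner_mul hg h1 h2 v) (integrable_inner_mul hg' h1 h2 v)]
    have := h η h1 h2 h3 v
    have := h' η h1 h2 h3 v
    linarith

variable (Ω) (q : ℝ≥0∞) [hq : Fact (1 ≤ q)]

/-- The Sobolev space `W^{1,q}(Ω)`: the functions in `L^q(Ω)` whose distributional gradient is in
`L^q(Ω; ℝ^N)`. -/
def W1 : Submodule ℝ (Lp ℝ q Ω.vol) where
  carrier := {u | ∃ g : Lp (EuclideanSpace ℝ (Fin N)) q Ω.vol, Ω.HasWeakGradient u g}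
  add_mem' := by
    rintro u u' ⟨g, h⟩ ⟨g', h'⟩
    exact ⟨g + g', (h.add h' ((Lp.memLp u).integrable hq.out) ((Lp.memLp u').integrable hq.out)
      ((Lp.memLp g).integrable hq.out) ((Lp.memLp g').integrable hq.out)).congr
      (Lp.coeFn_add u u').symm (Lp.coeFn_add g g').symm⟩
  zero_mem' := by
    refine ⟨0, HasWeakGradient.congr (u := 0) (g := 0) ?_ (Lp.coeFn_zero _ _ _).symm
      (Lp.coeFn_zero _ _ _).symm⟩
    intro η _ _ _ v
    simp
  smul_mem' := by
    rintro c u ⟨g, h⟩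
    exact ⟨c • g, (h.smul c).congr (Lp.coeFn_smul c u).symm (Lp.coeFn_smul c g).symm⟩

variable {Ω q}

theorem mem_W1 {u : Lp ℝ q Ω.vol} : u ∈ Ω.W1 q ↔
    ∃ g : Lp (EuclideanSpace ℝ (Fin N)) q Ω.vol, Ω.HasWeakGradient u g := Iff.rfl

theorem hasWeakGradient_choose (u : Ω.W1 q) :
    Ω.HasWeakGradient (u : Lp ℝ q Ω.vol)
      (Classical.choose (mem_W1.mp u.2) : Lp (EuclideanSpace ℝ (Fin N)) q Ω.vol) :=
  Classical.choose_spec (mem_W1.mp u.2)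

theorem weakGradient_eq {u : EuclideanSpace ℝ (Fin N) → ℝ}
    {g g' : Lp (EuclideanSpace ℝ (Fin N)) q Ω.vol}
    (h : Ω.HasWeakGradient u g) (h' : Ω.HasWeakGradient u g') : g = g' :=
  Lp.ext (h.unique h' ((Lp.memLp g).integrable hq.out) ((Lp.memLp g').integrable hq.out))

variable (Ω q)

/-- The gradient `∇ : W^{1,q}(Ω) → L^q(Ω; ℝ^N)`, the (unique) distributional gradient. -/
def grad : Ω.W1 q →ₗ[ℝ] Lp (EuclideanSpace ℝ (Fin N)) q Ω.vol where
  toFun u := Classical.choose (mem_W1.mp u.2)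
  map_add' u u' := by
    refine weakGradient_eq (hasWeakGradient_choose (u + u')) ?_
    exact ((hasWeakGradient_choose u).add (hasWeakGradient_choose u')
      ((Lp.memLp _).integrable hq.out) ((Lp.memLp _).integrable hq.out)
      ((Lp.memLp _).integrable hq.out) ((Lp.memLp _).integrable hq.out)).congr
      (Lp.coeFn_add _ _).symm (Lp.coeFn_add _ _).symm
  map_smul' c u := by
    refine weakGradient_eq (hasWeakGradient_choose (c • u)) ?_
    exact ((hasWeakGradient_choose u).smul c).congr (Lp.coeFn_smul _ _).symm
      (Lp.coeFn_smul _ _).symm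

variable {Ω q}

theorem hasWeakGradient_grad (u : Ω.W1 q) :
    Ω.HasWeakGradient (u : Lp ℝ q Ω.vol) (Ω.grad q u) :=
  hasWeakGradient_choose u

/-- A function that is `C¹` inside `Ω`, with integrable values and gradient, has its classical
gradient as distributional gradient. -/
theorem hasWeakGradient_of_contDiffOn {φ : EuclideanSpace ℝ (Fin N) → ℝ}
    (hφ : ContDiffOn ℝ 1 φ Ω.carrier) (h0 : Integrable φ Ω.vol)
    (h1 : Integrable (gradient φ) Ω.vol) : Ω.HasWeakGradient φ (gradient φ) := by
  intro η hη hc hs v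
  have hgr : ∀ x, inner ℝ (gradient φ x) v = fderiv ℝ φ x v := by
    intro x
    simp [gradient]
  have z1 : ∀ x, x ∉ Ω.carrier → φ x * fderiv ℝ η x v = 0 := by
    intro x hx
    have : x ∉ tsupport (fderiv ℝ η) := fun h => hx (hs (tsupport_fderiv_subset ℝ h))
    rw [image_eq_zero_of_notMem_tsupport this]
    simp
  have z2 : ∀ x, x ∉ Ω.carrier → fderiv ℝ φ x v * η x = 0 := by
    intro x hx
    rw [image_eq_zero_of_notMem_tsupport (fun h => hx (hs h)), mul_zero]
  have z3 : ∀ x, x ∉ Ω.carrier → φ x * η x = 0 := by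
    intro x hx
    rw [image_eq_zero_of_notMem_tsupport (fun h => hx (hs h)), mul_zero]
  have i1 : Integrable (fun x => φ x * fderiv ℝ η x v) :=
    (integrableOn_iff_integrable_of_support_subset
      (fun x hx => by by_contra h; exact hx (z1 x h))).mp (integrable_mul_fderiv h0 hη hc v)
  have i2 : Integrable (fun x => fderiv ℝ φ x v * η x) :=
    (integrableOn_iff_integrable_of_support_subset
      (fun x hx => by by_contra h; exact hx (z2 x h))).mp
      (by have := integrable_inner_mul h1 hη hc v; simp only [hgr] at this; exact this)
  have i3 : Integrable (fun x => φ x * η x) := by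
    obtain ⟨C, hC⟩ := hc.exists_bound_of_continuous hη.continuous
    exact (integrableOn_iff_integrable_of_support_subset (s := Ω.carrier)
      (fun x hx => by by_contra h; exact hx (z3 x h))).mp
      (h0.mul_bdd (c := C) hη.continuous.aestronglyMeasurable (Filter.Eventually.of_forall hC))
  simp only [hgr]
  rw [setIntegral_eq_integral_of_forall_compl_eq_zero z1,
    setIntegral_eq_integral_of_forall_compl_eq_zero z2]
  refine integral_mul_fderiv_eq_neg_fderiv_mul_of_integrable i2 i1 i3 ?_ ?_
  · intro x hx
    exact (hφ.contDiffAt (Ω.isOpen.mem_nhds (hs hx))).differentiableAt (by simp)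
  · intro x _
    exact (hη.differentiable (by simp)) x

variable (Ω)

/-- `φ ∈ C¹(Ω̄)`: `φ` is continuously differentiable on the compact set `Ω̄`, up to the boundary. -/
def IsC1 (φ : EuclideanSpace ℝ (Fin N) → ℝ) : Prop :=
  ContDiffOn ℝ 1 φ (closure Ω.carrier)

variable {Ω}

set_option linter.unusedSectionVars false

theorem IsC1.memLp {φ : EuclideanSpace ℝ (Fin N) → ℝ} (hφ : Ω.IsC1 φ) : MemLp φ q Ω.vol := by
  have hK : IsCompact (closure Ω.carrier) := Ω.bounded.isCompact_closure
  obtain ⟨C, hC⟩ := hK.exists_bound_of_continuousOn hφ.continuousOn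
  refine MemLp.of_bound
    ((hφ.continuousOn.mono subset_closure).aestronglyMeasurable Ω.isOpen.measurableSet) C ?_
  filter_upwards [ae_restrict_mem Ω.isOpen.measurableSet] with x hx
  exact hC x (subset_closure hx)

theorem IsC1.gradient_bound {φ : EuclideanSpace ℝ (Fin N) → ℝ} (hφ : Ω.IsC1 φ) :
    ∃ C, ∀ x ∈ Ω.carrier, ‖gradient φ x‖ ≤ C := by
  have hK : IsCompact (closure Ω.carrier) := Ω.bounded.isCompact_closure
  have key : ∃ C, ∀ x ∈ closure Ω.carrier ∩ Ω.carrier, ‖gradient φ x‖ ≤ C := by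
    refine hK.induction_on (p := fun s => ∃ C, ∀ x ∈ s ∩ Ω.carrier, ‖gradient φ x‖ ≤ C)
      ⟨0, by simp⟩ ?_ ?_ ?_
    · rintro s t hst ⟨C, hC⟩
      exact ⟨C, fun x hx => hC x ⟨hst hx.1, hx.2⟩⟩
    · rintro s t ⟨C, hC⟩ ⟨D, hD⟩
      refine ⟨max C D, ?_⟩
      rintro x ⟨hx | hx, hU⟩
      · exact (hC x ⟨hx, hU⟩).trans (le_max_left _ _)
      · exact (hD x ⟨hx, hU⟩).trans (le_max_right _ _)
    · intro x hx
      have h := hφ x hx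
      have h' : ContDiffWithinAt ℝ (0 + 1) φ (closure Ω.carrier) x := by simpa using h
      rw [contDiffWithinAt_succ_iff_hasFDerivWithinAt' (by simp)] at h'
      obtain ⟨u, hu, -, -, f', hf', hc⟩ := h'
      rw [insert_eq_of_mem hx] at hu
      have hb : ∀ᶠ y in 𝓝[closure Ω.carrier] x, ‖f' y‖ < ‖f' x‖ + 1 :=
        hc.continuousWithinAt.norm.eventually (gt_mem_nhds (lt_add_one _))
      refine ⟨u ∩ {y | ‖f' y‖ < ‖f' x‖ + 1}, Filter.inter_mem hu hb, ‖f' x‖ + 1, ?_⟩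
      rintro y ⟨⟨hyu, hyb⟩, hyU⟩
      have hn : closure Ω.carrier ∈ 𝓝 y :=
        Filter.mem_of_superset (Ω.isOpen.mem_nhds hyU) subset_closure
      have := ((hf' y hyu).hasFDerivAt hn).fderiv
      simpa [gradient, this] using le_of_lt hyb
  obtain ⟨C, hC⟩ := key
  exact ⟨C, fun x hx => hC x ⟨subset_closure hx, hx⟩⟩

theorem IsC1.memLp_gradient {φ : EuclideanSpace ℝ (Fin N) → ℝ} (hφ : Ω.IsC1 φ) :
    MemLp (gradient φ) q Ω.vol := by
  obtain ⟨C, hC⟩ := hφ.gradient_bound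
  have hc : ContinuousOn (gradient φ) Ω.carrier :=
    (LinearIsometryEquiv.continuous _).comp_continuousOn
      ((ContDiffOn.mono hφ subset_closure).continuousOn_fderiv_of_isOpen Ω.isOpen (by simp))
  refine MemLp.of_bound (hc.aestronglyMeasurable Ω.isOpen.measurableSet) C ?_
  filter_upwards [ae_restrict_mem Ω.isOpen.measurableSet] with x hx
  exact hC x hx

theorem IsC1.hasWeakGradient {φ : EuclideanSpace ℝ (Fin N) → ℝ} (hφ : Ω.IsC1 φ) :
    Ω.HasWeakGradient φ (gradient φ) :=
  hasWeakGradient_of_contDiffOn (ContDiffOn.mono hφ subset_closure)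
    (memLp_one_iff_integrable.mp hφ.memLp) (memLp_one_iff_integrable.mp hφ.memLp_gradient)

variable (q) in
/-- A function in `C¹(Ω̄)` as an element of `W^{1,q}(Ω)`. -/
def IsC1.toW1 {φ : EuclideanSpace ℝ (Fin N) → ℝ} (hφ : Ω.IsC1 φ) : Ω.W1 q :=
  ⟨hφ.memLp.toLp φ, hφ.memLp_gradient.toLp (gradient φ),
    hφ.hasWeakGradient.congr hφ.memLp.coeFn_toLp.symm hφ.memLp_gradient.coeFn_toLp.symm⟩

variable (Ω q)

/-- The a.e. constant functions in `W^{1,q}(Ω)`; two functions are equivalent in the quotient by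
this subspace iff their difference is a.e. equal to a constant. -/
def constants : Submodule ℝ (Ω.W1 q) where
  carrier := {u | ∃ c : ℝ, ∀ᵐ x ∂Ω.vol, (u : Lp ℝ q Ω.vol) x = c}
  add_mem' := by
    rintro u u' ⟨c, h⟩ ⟨c', h'⟩
    refine ⟨c + c', ?_⟩
    filter_upwards [h, h', Lp.coeFn_add (u : Lp ℝ q Ω.vol) u'] with x hx hx' ha
    rw [Submodule.coe_add, ha, Pi.add_apply, hx, hx']
  zero_mem' := ⟨0, by
    filter_upwards [Lp.coeFn_zero ℝ q Ω.vol] with x hx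
    simpa using hx⟩
  smul_mem' := by
    rintro a u ⟨c, h⟩
    refine ⟨a * c, ?_⟩
    filter_upwards [h, Lp.coeFn_smul a (u : Lp ℝ q Ω.vol)] with x hx ha
    rw [Submodule.coe_smul, ha, Pi.smul_apply, hx, smul_eq_mul]

/-- The space `Ẇ^{1,q}(Ω) = W^{1,q}(Ω) / ∼`, where `u ∼ v` iff `u - v` is a.e. constant. -/
def DotW : Type := Ω.W1 q ⧸ Ω.constants q

instance : AddCommGroup (Ω.DotW q) := inferInstanceAs (AddCommGroup (Ω.W1 q ⧸ Ω.constants q))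

instance : Module ℝ (Ω.DotW q) := inferInstanceAs (Module ℝ (Ω.W1 q ⧸ Ω.constants q))

/-- The class in `Ẇ^{1,q}(Ω)` of a function in `W^{1,q}(Ω)`. -/
def DotW.mk : Ω.W1 q →ₗ[ℝ] Ω.DotW q := (Ω.constants q).mkQ

theorem grad_eq_zero_of_mem_constants (u : Ω.W1 q) (hu : u ∈ Ω.constants q) :
    Ω.grad q u = 0 := by
  obtain ⟨c, hc⟩ := hu
  have h : Ω.HasWeakGradient (fun _ => c) (gradient fun _ => c) :=
    IsC1.hasWeakGradient (Ω := Ω) (contDiffOn_const (c := c))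
  refine weakGradient_eq (hasWeakGradient_grad u) ?_
  refine h.congr (Filter.EventuallyEq.symm hc) ?_
  filter_upwards [Lp.coeFn_zero (EuclideanSpace ℝ (Fin N)) q Ω.vol] with x hx
  rw [hx, gradient_fun_const]
  rfl

/-- The gradient on `Ẇ^{1,q}(Ω)`. -/
def DotW.grad : Ω.DotW q →ₗ[ℝ] Lp (EuclideanSpace ℝ (Fin N)) q Ω.vol :=
  (Ω.constants q).liftQ (Ω.grad q) (fun u hu => Ω.grad_eq_zero_of_mem_constants q u hu)

/-- `Ẇ^{1,q}(Ω)` carries the norm `‖u‖ = ‖∇u‖_{L^q(Ω)} = (∫_Ω |∇u|^q)^{1/q}`. -/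
instance : SeminormedAddCommGroup (Ω.DotW q) :=
  SeminormedAddCommGroup.induced (Ω.DotW q) (Lp (EuclideanSpace ℝ (Fin N)) q Ω.vol)
    (DotW.grad Ω q)

instance : NormedSpace ℝ (Ω.DotW q) :=
  NormedSpace.induced ℝ (Ω.DotW q) (Lp (EuclideanSpace ℝ (Fin N)) q Ω.vol) (DotW.grad Ω q)

theorem DotW.norm_mk (u : Ω.W1 q) : ‖DotW.mk Ω q u‖ = ‖Ω.grad q u‖ := rfl

/-- `Ẇ^{-1,p}(Ω)`, the dual space of `Ẇ^{1,q}(Ω)`, where `p` and `q` are conjugate exponents. -/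
abbrev DotWDual : Type := StrongDual ℝ (Ω.DotW q)

variable {Ω q}

/-- The dual norm `‖T‖ = sup {⟨T, φ⟩ : φ ∈ Ẇ^{1,q}(Ω), ‖φ‖ = 1}`. -/
def dualNorm (T : Ω.DotWDual q) : ℝ :=
  sSup {r : ℝ | ∃ φ : Ω.DotW q, ‖φ‖ = 1 ∧ T φ = r}

/-- `-div V = T` in `Ω` and `V · ν_Ω = 0` on `∂Ω`, in the weak sense:
`∫_Ω ∇φ · V dx = ⟨T, φ⟩` for every `φ ∈ C¹(Ω̄)`. -/
def SolvesNeumann {p : ℝ≥0∞} (V : Lp (EuclideanSpace ℝ (Fin N)) p Ω.vol)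
    (T : Ω.DotWDual q) : Prop :=
  ∀ (φ : EuclideanSpace ℝ (Fin N) → ℝ) (hφ : Ω.IsC1 φ),
    ∫ x in Ω.carrier, inner ℝ (gradient φ x) (V x) = T (DotW.mk Ω q (hφ.toW1 q))

end SmoothDomain

end

/-! The supremum over unit vectors is the operator norm ‖T‖, so two inequalities are needed.
Attainment: the gradient embeds Ẇ^{1,q} isometrically in L^q(Ω; ℝ^N), hence T becomes a functional
of norm at most ‖T‖ on the space of gradients. Hahn–Banach extends it to L^q with the same norm, and
the Riesz representation `exists_Lp_density_of_dual_Lp` turns the extension into a field V in L^p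
with ‖V‖ ≤ ‖T‖. Lower bound: if V solves the equation, Hölder gives |T φ| ≤ ‖∇φ‖ ‖V‖, but only for φ
in C¹ up to the boundary. Passing to all of W^{1,q} requires approximating gradients in L^q by
gradients of such functions (`exists_isC1_grad_near`), the only place where the smooth boundary
enters. A partition of unity localizes u, and each piece, extended by zero, is mollified with a
kernel shifted so that points of Ω sample only points of Ω. The jump of the extension across ∂Ω is
then never seen. -/

/-! ### Functionals on L^q: an integrable density by Radon–Nikodym -/

theorem continuousLinearMap_ext_indicatorConstLp {α E : Type*} [MeasurableSpace α] {μ : Measure α}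
    [IsFiniteMeasure μ] [NormedAddCommGroup E] [NormedSpace ℝ E] {q : ℝ≥0∞} [Fact (1 ≤ q)]
    (hq : q ≠ ⊤) {S T : Lp E q μ →L[ℝ] ℝ}
    (h : ∀ (A : Set α) (hA : MeasurableSet A) (c : E),
      S (indicatorConstLp q hA (measure_ne_top μ A) c)
        = T (indicatorConstLp q hA (measure_ne_top μ A) c)) : S = T := by
  ext f
  refine Lp.induction hq (motive := fun f => S f = T f) ?_ ?_ ?_ f
  · intro c A hA hμA
    exact h A hA c
  · intro f g hf hg _ h1 h2
    rw [map_add, map_add, h1, h2]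
  · exact isClosed_eq S.continuous T.continuous

/-- For fixed c, the set function A ↦ L(1_A c) is a signed measure absolutely continuous with
respect to μ. Its Radon–Nikodym density gives one component of V; an orthonormal basis assembles
them. Membership in L^p is a separate matter. -/
theorem exists_integrable_density_of_dual_Lp {α E : Type*} [MeasurableSpace α] {μ : Measure α}
    [IsFiniteMeasure μ] [NormedAddCommGroup E] [InnerProductSpace ℝ E] [FiniteDimensional ℝ E]
    {q : ℝ≥0∞} [hq1 : Fact (1 ≤ q)] (hq : q ≠ ⊤) (L : Lp E q μ →L[ℝ] ℝ) :
    ∃ V : α → E, StronglyMeasurable V ∧ Integrable V μ ∧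
      ∀ (A : Set α) (hA : MeasurableSet A) (c : E),
        L (indicatorConstLp q hA (measure_ne_top μ A) c) = ∫ x in A, inner ℝ c (V x) ∂μ := by
  classical
  have hq0 : q ≠ 0 := (one_pos.trans_le hq1.out).ne'
  have zero_of_null : ∀ (A : Set α) (hA : MeasurableSet A) (c : E), μ A = 0 →
      indicatorConstLp q hA (measure_ne_top μ A) c = 0 := by
    intro A hA c h0
    rw [← norm_eq_zero, norm_indicatorConstLp hq0 hq]
    have : 0 < q.toReal := ENNReal.toReal_pos hq0 hq
    simp [measureReal_def, h0, this.ne']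
  have key : ∀ c : E, ∃ f : α → ℝ, StronglyMeasurable f ∧ Integrable f μ ∧
      ∀ (A : Set α) (hA : MeasurableSet A),
        L (indicatorConstLp q hA (measure_ne_top μ A) c) = ∫ x in A, f x ∂μ := by
    intro c
    let s : SignedMeasure α :=
      { measureOf' := fun A => if hA : MeasurableSet A then
          L (indicatorConstLp q hA (measure_ne_top μ A) c) else 0
        empty' := by
          rw [dif_pos MeasurableSet.empty, zero_of_null _ _ _ measure_empty, map_zero]
        not_measurable' := fun A hA => dif_neg hA
        m_iUnion' := by
          intro f hf hd
          have hfin : ∀ t : Finset ℕ, MeasurableSet (⋃ i ∈ t, f i) :=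
            fun t => t.measurableSet_biUnion fun i _ => hf i
          have hsum : ∀ t : Finset ℕ,
              ∑ i ∈ t, indicatorConstLp q (hf i) (measure_ne_top μ (f i)) c
                = indicatorConstLp q (hfin t) (measure_ne_top μ _) c := by
            intro t
            induction t using Finset.induction_on with
            | empty =>
              rw [Finset.sum_empty, zero_of_null _ _ _ (by simp)]
            | insert a t ha ih =>
              rw [Finset.sum_insert ha, ih]
              have hdis : Disjoint (f a) (⋃ i ∈ t, f i) := by
                rw [disjoint_iUnion₂_right]
                intro i hi
                exact hd (fun h => ha (h ▸ hi))
              rw [← indicatorConstLp_disjoint_union (hf a) (hfin t) (measure_ne_top _ _)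
                (measure_ne_top _ _) hdis]
              congr 1
              exact (Finset.set_biUnion_insert a t f).symm
          simp only [dif_pos (hf _), dif_pos (MeasurableSet.iUnion hf)]
          refine HasSum.map (g := L) ?_ L.continuous
          rw [HasSum, SummationFilter.unconditional_filter]
          simp only [hsum]
          -- Partial sums are indicators of finite unions. They converge in L^q because the missing
          -- set has measure at most a tail of the convergent series ∑ μ(f i).
          refine tendsto_indicatorConstLp_set hq ?_
          have hle : ∑' i, μ (f i) ≠ ⊤ := by
            rw [← measure_iUnion hd hf]
            exact measure_ne_top _ _
          refine tendsto_of_tendsto_of_tendsto_of_le_of_le tendsto_const_nhds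
            (ENNReal.tendsto_tsum_compl_atTop_zero hle) (fun _ => zero_le) fun t => ?_
          refine (measure_mono (t := ⋃ i : { i // i ∉ t }, f i) ?_).trans (measure_iUnion_le _)
          rintro x (⟨hx, hx'⟩ | ⟨hx, hx'⟩)
          · exact absurd (iUnion₂_subset_iUnion _ _ hx) hx'
          · obtain ⟨i, hi⟩ := mem_iUnion.mp hx
            exact mem_iUnion.mpr ⟨⟨i, fun h => hx' (mem_iUnion₂.mpr ⟨i, h, hi⟩)⟩, hi⟩ }
    have hs : ∀ (A : Set α) (hA : MeasurableSet A),
        s A = L (indicatorConstLp q hA (measure_ne_top μ A) c) := fun A hA => dif_pos hA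
    have hac : VectorMeasure.AbsolutelyContinuous s μ.toENNRealVectorMeasure := by
      refine VectorMeasure.AbsolutelyContinuous.mk fun A hA h0 => ?_
      rw [Measure.toENNRealVectorMeasure_apply_measurable hA] at h0
      rw [hs A hA, zero_of_null _ _ _ h0, map_zero]
    have hrn := SignedMeasure.withDensityᵥ_rnDeriv_eq s μ hac
    refine ⟨s.rnDeriv μ, (SignedMeasure.measurable_rnDeriv s μ).stronglyMeasurable,
      SignedMeasure.integrable_rnDeriv s μ, fun A hA => ?_⟩
    rw [← hs A hA, ← withDensityᵥ_apply (SignedMeasure.integrable_rnDeriv s μ) hA, hrn]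
  choose F hFm hFi hF using key
  let b := stdOrthonormalBasis ℝ E
  refine ⟨fun x => ∑ i, F (b i) x • b i,
    Finset.stronglyMeasurable_fun_sum _ fun i _ => (hFm _).smul_const _,
    integrable_finsetSum _ fun i _ => (hFi _).smul_const _, fun A hA c => ?_⟩
  have hc : indicatorConstLp q hA (measure_ne_top μ A) c
      = ∑ i, inner ℝ (b i) c • indicatorConstLp q hA (measure_ne_top μ A) (b i) := by
    ext1
    refine (indicatorConstLp_coeFn).trans ?_
    refine Filter.EventuallyEq.symm ((Lp.coeFn_fun_finsetSum _ _).trans ?_)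
    have : ∀ᵐ x ∂μ, ∀ i, (inner ℝ (b i) c • indicatorConstLp q hA (measure_ne_top μ A) (b i)
        : Lp E q μ) x = inner ℝ (b i) c • A.indicator (fun _ => b i) x := by
      refine ae_all_iff.mpr fun i => ?_
      filter_upwards [Lp.coeFn_smul (inner ℝ (b i) c)
        (indicatorConstLp q hA (measure_ne_top μ A) (b i)),
        indicatorConstLp_coeFn (p := q) (hs := hA) (hμs := measure_ne_top μ A) (c := b i)]
        with x h1 h2
      rw [h1, Pi.smul_apply, h2]
    filter_upwards [this] with x hx
    simp only [hx]
    by_cases hxA : x ∈ A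
    · simp [hxA, b.sum_repr' c]
    · simp [hxA]
  rw [hc, map_sum]
  simp only [map_smul, hF, smul_eq_mul, inner_sum, real_inner_smul_right]
  rw [integral_finsetSum _ fun i _ => (((hFi _).mul_const _).integrableOn)]
  refine Finset.sum_congr rfl fun i _ => ?_
  rw [integral_mul_const, mul_comm, real_inner_comm]

/-! ### Translation and mollification in L^q -/

theorem exists_eLpNorm_translate_sub_le {E F : Type*} [NormedAddCommGroup E] [MeasurableSpace E]
    [BorelSpace E] [LocallyCompactSpace E] [SecondCountableTopology E]
    [NormedAddCommGroup F] {μ : Measure E} [μ.IsAddHaarMeasure] {q : ℝ≥0∞} [Fact (1 ≤ q)]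
    (hq : q ≠ ⊤) {G : E → F} (hG : MemLp G q μ) {ε : ℝ≥0∞} (hε : 0 < ε) :
    ∃ τ : ℝ, 0 < τ ∧ ∀ y, ‖y‖ ≤ τ → eLpNorm (fun x => G (x - y) - G x) q μ ≤ ε := by
  let T : E → C(E, E) := fun y => ⟨fun x => x - y, by fun_prop⟩
  have hT : ∀ y, MeasurePreserving (T y) μ μ := fun y => measurePreserving_sub_right μ y
  have hTc : Continuous T :=
    (ContinuousMap.curry (⟨fun p : E × E => p.2 - p.1, by fun_prop⟩ : C(E × E, E))).continuous
  have hcont : Continuous (fun y => Lp.compMeasurePreserving (T y) (hT y) (hG.toLp G)) :=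
    Continuous.compMeasurePreservingLp continuous_const hTc hT hq
  have hval : ∀ y, (Lp.compMeasurePreserving (T y) (hT y) (hG.toLp G) : E → F)
      =ᵐ[μ] fun x => G (x - y) := fun y =>
    (Lp.coeFn_compMeasurePreserving _ (hT y)).trans
      ((hT y).quasiMeasurePreserving.ae_eq_comp hG.coeFn_toLp)
  have h0 := (EMetric.tendsto_nhds.mp (hcont.tendsto 0)) ε hε
  obtain ⟨τ, hτ, hb⟩ := Metric.eventually_nhds_iff.mp h0
  refine ⟨τ / 2, half_pos hτ, fun y hy => ?_⟩
  have := hb (y := y) (by rw [dist_zero_right]; linarith)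
  rw [Lp.edist_def] at this
  refine le_of_eq_of_le (eLpNorm_congr_ae ?_) this.le
  filter_upwards [hval y, hval 0] with x h1 h2
  rw [Pi.sub_apply, h1, h2, sub_zero]

/-- Since K dμ is a probability measure, the average of G(x - y) - G(x) is bounded pointwise by its
L^q norm in y. Tonelli then reduces the claim to the bound for each single translation. -/
theorem eLpNorm_integral_translate_sub_le {E F : Type*} [NormedAddCommGroup E] [NormedSpace ℝ E]
    [FiniteDimensional ℝ E] [MeasurableSpace E]
    [BorelSpace E] [NormedAddCommGroup F] [NormedSpace ℝ F] [CompleteSpace F]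
    {μ : Measure E} [μ.IsAddHaarMeasure] {q : ℝ≥0∞} [hq1 : Fact (1 ≤ q)]
    (hq : q ≠ ⊤) {G : E → F} (hGm : StronglyMeasurable G) (hG : MemLp G q μ) {K : E → ℝ}
    (hK : Continuous K) (hKs : HasCompactSupport K) (hK0 : ∀ y, 0 ≤ K y) (hK1 : ∫ y, K y ∂μ = 1)
    {ε : ℝ≥0∞} (h : ∀ y, K y ≠ 0 → eLpNorm (fun x => G (x - y) - G x) q μ ≤ ε) :
    eLpNorm (fun x => (∫ y, K y • G (x - y) ∂μ) - G x) q μ ≤ ε := by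
  have hq0 : q ≠ 0 := (one_pos.trans_le hq1.out).ne'
  have hqr : 0 < q.toReal := ENNReal.toReal_pos hq0 hq
  have hKi : Integrable K μ := hK.integrable_of_hasCompactSupport hKs
  let k : E → ℝ≥0∞ := fun y => ENNReal.ofReal (K y)
  have hkm : Measurable k := hK.measurable.ennreal_ofReal
  let ν := μ.withDensity k
  have : IsProbabilityMeasure ν := ⟨by
    rw [withDensity_apply _ MeasurableSet.univ, Measure.restrict_univ,
      ← ofReal_integral_eq_lintegral_ofReal hKi (Filter.Eventually.of_forall hK0), hK1,
      ENNReal.ofReal_one]⟩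
  have hHm : StronglyMeasurable (fun p : E × E => G (p.1 - p.2) - G p.1) :=
    (hGm.comp_measurable (measurable_fst.sub measurable_snd)).sub
      (hGm.comp_measurable measurable_fst)
  have hGl : LocallyIntegrable G μ := hG.locallyIntegrable hq1.out
  have pt : ∀ x, ‖(∫ y, K y • G (x - y) ∂μ) - G x‖ₑ ^ q.toReal
      ≤ ∫⁻ y, ‖G (x - y) - G x‖ₑ ^ q.toReal ∂ν := by
    intro x
    have hi : Integrable (fun y => K y • G (x - y)) μ :=
      (hKs.convolutionExists_left (ContinuousLinearMap.lsmul ℝ ℝ) hK hGl x).integrable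
    have e : (∫ y, K y • G (x - y) ∂μ) - G x = ∫ y, K y • (G (x - y) - G x) ∂μ := by
      simp only [smul_sub]
      rw [integral_sub hi (hKi.smul_const _), integral_smul_const, hK1, one_smul]
    have hm : AEStronglyMeasurable (fun y => G (x - y) - G x) ν :=
      (hHm.comp_measurable measurable_prodMk_left).aestronglyMeasurable
    have h1 : ‖(∫ y, K y • G (x - y) ∂μ) - G x‖ₑ ≤ eLpNorm (fun y => G (x - y) - G x) 1 ν := by
      rw [e, eLpNorm_one_eq_lintegral_enorm,
        lintegral_withDensity_eq_lintegral_mul _ hkm (f := k)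
          (g := fun y => ‖G (x - y) - G x‖ₑ)
          (hHm.comp_measurable measurable_prodMk_left).enorm]
      refine (enorm_integral_le_lintegral_enorm _).trans (le_of_eq (lintegral_congr fun y => ?_))
      rw [enorm_smul, Pi.mul_apply, Real.enorm_of_nonneg (hK0 y)]
    have h2 := h1.trans (eLpNorm_le_eLpNorm_of_exponent_le hq1.out hm)
    rw [eLpNorm_eq_lintegral_rpow_enorm_toReal hq0 hq] at h2
    calc _ ≤ _ := ENNReal.rpow_le_rpow h2 hqr.le
      _ = _ := by rw [← ENNReal.rpow_mul, one_div, inv_mul_cancel₀ hqr.ne', ENNReal.rpow_one]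
  have main : ∫⁻ x, ‖(∫ y, K y • G (x - y) ∂μ) - G x‖ₑ ^ q.toReal ∂μ ≤ ε ^ q.toReal := by
    have hHm' : Measurable (fun p : E × E => ‖G (p.1 - p.2) - G p.1‖ₑ ^ q.toReal) :=
      hHm.enorm.pow_const _
    calc _ ≤ ∫⁻ x, ∫⁻ y, ‖G (x - y) - G x‖ₑ ^ q.toReal ∂ν ∂μ := lintegral_mono pt
      _ = ∫⁻ y, ∫⁻ x, ‖G (x - y) - G x‖ₑ ^ q.toReal ∂μ ∂ν :=
        lintegral_lintegral_swap hHm'.aemeasurable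
      _ ≤ ∫⁻ _, ε ^ q.toReal ∂ν := by
        refine lintegral_mono_ae ?_
        rw [ae_withDensity_iff hkm]
        refine Filter.Eventually.of_forall fun y hy => ?_
        have hy' : K y ≠ 0 := fun h0 => hy (by simp [k, h0])
        have := h y hy'
        rw [eLpNorm_eq_lintegral_rpow_enorm_toReal hq0 hq] at this
        calc _ = ((∫⁻ x, ‖G (x - y) - G x‖ₑ ^ q.toReal ∂μ) ^ (1 / q.toReal)) ^ q.toReal := by
              rw [← ENNReal.rpow_mul, one_div, inv_mul_cancel₀ hqr.ne', ENNReal.rpow_one]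
          _ ≤ _ := ENNReal.rpow_le_rpow this hqr.le
      _ = ε ^ q.toReal := by rw [lintegral_const, measure_univ, mul_one]
  rw [eLpNorm_eq_lintegral_rpow_enorm_toReal hq0 hq]
  calc _ ≤ (ε ^ q.toReal) ^ (1 / q.toReal) := ENNReal.rpow_le_rpow main (by positivity)
    _ = ε := by rw [← ENNReal.rpow_mul, one_div, mul_inv_cancel₀ hqr.ne', ENNReal.rpow_one]

/-! ### Boundary geometry, and gradients of mollified zero extensions -/

namespace SmoothDomain

/-- Along an inward direction w with dρ(x₀) w = -2, a step of length t lowers ρ by 2t to first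
order. An error of size κt costs at most t/2, and the linearization error near x₀ at most t. So ρ(z)
≤ ρ(x) - t/2 < 0. -/
theorem exists_transversal_direction {N : ℕ} (Ω : SmoothDomain N) {x₀ : EuclideanSpace ℝ (Fin N)}
    (hx₀ : x₀ ∈ closure Ω.carrier) :
    ∃ (r : ℝ) (w : EuclideanSpace ℝ (Fin N)) (κ δ : ℝ), 0 < r ∧ 0 < κ ∧ 0 < δ ∧
      ∀ t, 0 < t → t < δ → ∀ x ∈ Ω.carrier, ∀ z ∈ Metric.ball x₀ r,
        ‖z - (x + t • w)‖ ≤ κ * t → z ∈ Ω.carrier := by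
  by_cases hin : x₀ ∈ Ω.carrier
  · obtain ⟨r, hr, hb⟩ := Metric.isOpen_iff.mp Ω.isOpen x₀ hin
    -- At an interior point the ball itself lies in Ω, so any direction serves.
    exact ⟨r, 0, 1, 1, hr, one_pos, one_pos, fun t _ _ x _ z hz _ => hb hz⟩
  have hfr : x₀ ∈ frontier Ω.carrier := ⟨hx₀, by rwa [Ω.isOpen.interior_eq]⟩
  obtain ⟨W, ρ, hWo, hxW, hρ, hne, hiff⟩ := Ω.smooth_boundary x₀ hfr
  have hst : HasStrictFDerivAt ρ (fderiv ℝ ρ x₀) x₀ :=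
    ((hρ.contDiffAt (hWo.mem_nhds hxW)).of_le (m := 1) (by simp)).hasStrictFDerivAt (by simp)
  set A := fderiv ℝ ρ x₀
  obtain ⟨w, hw⟩ : ∃ w, A w = -2 := by
    obtain ⟨v, hv⟩ : ∃ v, A v ≠ 0 := by
      by_contra! h
      exact hne (ContinuousLinearMap.ext h)
    exact ⟨(-2 / A v) • v, by rw [map_smul, smul_eq_mul]; field_simp⟩
  set κ : ℝ := 1 / (2 * (‖A‖ + 1))
  have hκ : 0 < κ := by positivity
  have hAκ : ‖A‖ * κ ≤ 1 / 2 := by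
    rw [mul_one_div, div_le_div_iff₀ (by positivity) (by positivity)]
    linarith
  -- The tolerance in strict differentiability: since ‖z - x‖ ≤ t(‖w‖ + κ), the error c‖z - x‖ is at
  -- most t.
  set c : ℝ := 1 / (‖w‖ + κ)
  have hc : 0 < c := by positivity
  have hcb : c * (‖w‖ + κ) = 1 := by
    have : ‖w‖ + κ ≠ 0 := by positivity
    simp only [c]
    field_simp
  have hlip := hst.isLittleO.def hc
  have hW2 : ∀ᶠ p in 𝓝 (x₀, x₀), p.1 ∈ W ∧ p.2 ∈ W :=
    (continuous_fst.continuousAt.eventually (hWo.mem_nhds hxW)).and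
      (continuous_snd.continuousAt.eventually (hWo.mem_nhds hxW))
  obtain ⟨s, hs, hev⟩ := Metric.eventually_nhds_iff.mp (hlip.and hW2)
  -- Only z is assumed close to x₀. The bound on t gives ‖z - x‖ < s/2, which brings x within s of
  -- x₀ too.
  refine ⟨s / 2, w, κ, s / 2 * c, by positivity, hκ, by positivity, ?_⟩
  intro t ht0 htδ x hx z hz hzx
  have hzx' : ‖z - x‖ ≤ t * (‖w‖ + κ) := by
    have e : z - x = (z - (x + t • w)) + t • w := by abel
    rw [e]
    refine (norm_add_le _ _).trans ?_
    rw [norm_smul, Real.norm_of_nonneg ht0.le]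
    linarith
  have hts : t * (‖w‖ + κ) < s / 2 := by
    calc t * (‖w‖ + κ) < s / 2 * c * (‖w‖ + κ) := by gcongr
      _ = s / 2 := by rw [mul_assoc, hcb, mul_one]
  have hz0 : dist z x₀ < s / 2 := hz
  have hx0 : dist x x₀ < s := by
    have : dist x z ≤ t * (‖w‖ + κ) := by rwa [dist_comm, dist_eq_norm]
    linarith [dist_triangle x z x₀]
  obtain ⟨hest, hzW, hxW'⟩ := hev (y := (z, x)) (by
    rw [Prod.dist_eq]; exact max_lt (by simp only; linarith) hx0)
  simp only at hest hzW hxW'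
  have hρx := (hiff x hxW').mp hx
  refine (hiff z hzW).mpr ?_
  have hA : A (z - x) ≤ -(3 / 2) * t := by
    have e : z - x = (z - (x + t • w)) + t • w := by abel
    rw [e, map_add, map_smul, hw, smul_eq_mul]
    have h1 : A (z - (x + t • w)) ≤ ‖A‖ * (κ * t) :=
      (le_abs_self _).trans ((A.le_opNorm _).trans (by gcongr))
    have h2 : ‖A‖ * (κ * t) ≤ 1 / 2 * t := by rw [← mul_assoc]; gcongr
    linarith
  have h3 : c * ‖z - x‖ ≤ t := by
    calc c * ‖z - x‖ ≤ c * (t * (‖w‖ + κ)) := by gcongr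
      _ = t * (c * (‖w‖ + κ)) := by ring
      _ = t := by rw [hcb, mul_one]
  have h4 := (le_abs_self _).trans hest
  linarith

/-- The derivative is put on K, and the weak gradient identity is tested with z ↦ ψ(z) K(x - z). The
support condition `hx` makes this test function compactly supported in Ω, so that no boundary term
appears although the extended function may jump across ∂Ω. -/
theorem gradient_convolution_eq {N : ℕ} {Ω : SmoothDomain N}
    {u : EuclideanSpace ℝ (Fin N) → ℝ} {g : EuclideanSpace ℝ (Fin N) → EuclideanSpace ℝ (Fin N)}
    (hug : Ω.HasWeakGradient u g) (hu : Integrable u Ω.vol) (hg : Integrable g Ω.vol)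
    {ψ K : EuclideanSpace ℝ (Fin N) → ℝ} (hψ : ContDiff ℝ ∞ ψ) (hψs : HasCompactSupport ψ)
    (hK : ContDiff ℝ ∞ K) (hKs : HasCompactSupport K) (x : EuclideanSpace ℝ (Fin N))
    (hx : ∀ z ∈ tsupport ψ, x - z ∈ tsupport K → z ∈ Ω.carrier) :
    gradient (convolution K (Ω.carrier.indicator fun z => ψ z * u z)
        (ContinuousLinearMap.lsmul ℝ ℝ) volume) x
      = ∫ y, K y • Ω.carrier.indicator (fun z => ψ z • g z + u z • gradient ψ z) (x - y) := by
  have hgr : ∀ (f : EuclideanSpace ℝ (Fin N) → ℝ) z v,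
      inner ℝ (gradient f z) v = fderiv ℝ f z v := by
    intro f z v
    simp [gradient]
  have hmΩ := Ω.isOpen.measurableSet
  obtain ⟨Cψ, hCψ⟩ := hψs.exists_bound_of_continuous hψ.continuous
  have hdψc : Continuous (fderiv ℝ ψ) := hψ.continuous_fderiv (by simp)
  have hgψc : Continuous (gradient ψ) := (LinearIsometryEquiv.continuous _).comp hdψc
  obtain ⟨Dψ, hDψ⟩ := (hψs.fderiv (𝕜 := ℝ)).exists_bound_of_continuous hdψc
  have hv0 : Integrable (fun z => ψ z * u z) Ω.vol :=
    hu.bdd_mul (c := Cψ) hψ.continuous.aestronglyMeasurable (Filter.Eventually.of_forall hCψ)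
  have hG : Integrable (fun z => ψ z • g z + u z • gradient ψ z) Ω.vol := by
    refine (hg.bdd_smul Cψ hψ.continuous.aestronglyMeasurable
      (Filter.Eventually.of_forall hCψ)).add ?_
    refine hu.smul_bdd Dψ hgψc.aestronglyMeasurable (Filter.Eventually.of_forall fun z => ?_)
    simpa [gradient] using hDψ z
  have hv0' : LocallyIntegrable (Ω.carrier.indicator fun z => ψ z * u z) volume :=
    ((integrable_indicator_iff hmΩ).mpr hv0).locallyIntegrable
  have hG' : LocallyIntegrable
      (Ω.carrier.indicator fun z => ψ z • g z + u z • gradient ψ z) volume :=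
    ((integrable_indicator_iff hmΩ).mpr hG).locallyIntegrable
  refine ext_inner_right ℝ fun v => ?_
  rw [hgr, (hKs.hasFDerivAt_convolution_left (ContinuousLinearMap.lsmul ℝ ℝ)
    (hK.of_le (by simp)) hv0' x).fderiv]
  have hdKc : Continuous (fderiv ℝ K) := hK.continuous_fderiv (by simp)
  have i1 := ((hKs.fderiv (𝕜 := ℝ)).convolutionExists_left
    ((ContinuousLinearMap.lsmul ℝ ℝ).precompL (EuclideanSpace ℝ (Fin N))) hdKc hv0' x).integrable
  have i2 : Integrable (fun y => K y • Ω.carrier.indicator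
      (fun z => ψ z • g z + u z • gradient ψ z) (x - y)) volume :=
    (hKs.convolutionExists_left (ContinuousLinearMap.lsmul ℝ ℝ) hK.continuous hG' x).integrable
  have lhs : (convolution (fderiv ℝ K) (Ω.carrier.indicator fun z => ψ z * u z)
      ((ContinuousLinearMap.lsmul ℝ ℝ).precompL (EuclideanSpace ℝ (Fin N))) volume x) v
      = ∫ z in Ω.carrier, fderiv ℝ K (x - z) v * (ψ z * u z) := by
    rw [convolution_def, ContinuousLinearMap.integral_apply i1, ← integral_indicator hmΩ,
      ← integral_sub_left_eq_self
        (Ω.carrier.indicator fun z => fderiv ℝ K (x - z) v * (ψ z * u z)) volume x]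
    refine integral_congr_ae (Filter.Eventually.of_forall fun y => ?_)
    by_cases hy : x - y ∈ Ω.carrier <;> simp [hy, ContinuousLinearMap.precompL_apply]
  have rhs : inner ℝ (∫ y, K y • Ω.carrier.indicator
      (fun z => ψ z • g z + u z • gradient ψ z) (x - y)) v
      = ∫ z in Ω.carrier, K (x - z) * (ψ z * inner ℝ (g z) v + u z * fderiv ℝ ψ z v) := by
    rw [real_inner_comm, ← integral_inner i2, ← integral_indicator hmΩ,
      ← integral_sub_left_eq_self
        (Ω.carrier.indicator fun z => K (x - z) * (ψ z * inner ℝ (g z) v + u z * fderiv ℝ ψ z v))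
        volume x]
    refine integral_congr_ae (Filter.Eventually.of_forall fun y => ?_)
    by_cases hy : x - y ∈ Ω.carrier
    · simp only [indicator_of_mem hy, real_inner_smul_right, inner_add_right, ← hgr,
        real_inner_comm v, sub_sub_cancel]
    · simp [hy]
  rw [lhs, rhs]
  have hη : ContDiff ℝ ∞ (fun z => K (x - z)) := hK.comp (contDiff_const.sub contDiff_id)
  have hηψ : ContDiff ℝ ∞ (fun z => ψ z * K (x - z)) := hψ.mul hη
  have hsub : tsupport (fun z => ψ z * K (x - z)) ⊆ Ω.carrier := by
    intro z hz
    refine hx z (tsupport_mul_subset_left hz) ?_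
    have h1 : z ∈ tsupport (fun z => K (x - z)) := tsupport_mul_subset_right hz
    exact tsupport_comp_subset_preimage K (f := fun z => x - z) (by fun_prop) h1
  have hηψs : HasCompactSupport (fun z => ψ z * K (x - z)) := hψs.mul_right
  have hweak := hug _ hηψ hηψs hsub v
  have hder : ∀ z, fderiv ℝ (fun z => ψ z * K (x - z)) z v
      = K (x - z) * fderiv ℝ ψ z v - ψ z * fderiv ℝ K (x - z) v := by
    intro z
    have h1 : HasFDerivAt (fun z => K (x - z)) (-(fderiv ℝ K (x - z))) z := by
      have := ((hK.differentiable (by simp)) (x - z)).hasFDerivAt.comp z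
        ((hasFDerivAt_id z).const_sub x)
      exact HasFDerivAt.congr_fderiv (f := fun z => K (x - z)) this (by ext; simp)
    have h2 := ((hψ.differentiable (by simp)) z).hasFDerivAt.mul h1
    have h3 : fderiv ℝ (fun z => ψ z * K (x - z)) z
        = ψ z • -fderiv ℝ K (x - z) + K (x - z) • fderiv ℝ ψ z := h2.fderiv
    rw [h3]
    simp
    ring
  obtain ⟨CK, hCK⟩ := hKs.exists_bound_of_continuous hK.continuous
  have hKm : Continuous (fun z => K (x - z)) := hη.continuous
  have j0 : Integrable (fun z => u z * fderiv ℝ (fun z => ψ z * K (x - z)) z v) Ω.vol :=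
    integrable_mul_fderiv hu hηψ hηψs v
  have j1 : Integrable (fun z => inner ℝ (g z) v * (ψ z * K (x - z))) Ω.vol :=
    integrable_inner_mul hg hηψ hηψs v
  have j2 : Integrable (fun z => K (x - z) * (u z * fderiv ℝ ψ z v)) Ω.vol :=
    (integrable_mul_fderiv hu hψ hψs v).bdd_mul (c := CK) hKm.aestronglyMeasurable
      (Filter.Eventually.of_forall fun z => hCK _)
  calc ∫ z in Ω.carrier, fderiv ℝ K (x - z) v * (ψ z * u z)
      = ∫ z in Ω.carrier, (K (x - z) * (u z * fderiv ℝ ψ z v)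
          - u z * fderiv ℝ (fun z => ψ z * K (x - z)) z v) := by
        refine integral_congr_ae (Filter.Eventually.of_forall fun z => ?_)
        simp only [hder]
        ring
    _ = (∫ z in Ω.carrier, K (x - z) * (u z * fderiv ℝ ψ z v))
          + ∫ z in Ω.carrier, inner ℝ (g z) v * (ψ z * K (x - z)) := by
        rw [integral_sub j2 j0, hweak, sub_neg_eq_add]
    _ = _ := by
        rw [← integral_add j2 j1]
        refine integral_congr_ae (Filter.Eventually.of_forall fun z => ?_)
        simp only
        ring

end SmoothDomain

/-! ### Riesz representation: the density lies in L^p -/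

/-- Testing L on the extremal of Hölder's inequality bounds the L^p norm of V by ‖L‖. As V is only
known to be integrable, this is done for truncations, and Fatou's lemma passes to the limit. -/
theorem exists_Lp_density_of_dual_Lp {α E : Type*} [MeasurableSpace α] {μ : Measure α}
    [IsFiniteMeasure μ] [NormedAddCommGroup E] [InnerProductSpace ℝ E] [FiniteDimensional ℝ E]
    {p q : ℝ≥0∞} [hp1 : Fact (1 ≤ p)] [hq1 : Fact (1 ≤ q)] [hpq : ENNReal.HolderConjugate p q]
    (hp : p ≠ ⊤) (hq : q ≠ ⊤) (L : Lp E q μ →L[ℝ] ℝ) :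
    ∃ V : Lp E p μ, (∀ f : Lp E q μ, L f = ∫ x, inner ℝ (f x) (V x) ∂μ) ∧ ‖V‖ ≤ ‖L‖ := by
  have : CompleteSpace E := FiniteDimensional.complete ℝ E
  have : ENNReal.HolderConjugate q p := hpq.symm
  obtain ⟨V, hVm, hVi, hV⟩ := exists_integrable_density_of_dual_Lp hq L
  have hr : p.toReal.HolderConjugate q.toReal := ENNReal.HolderConjugate.toReal_of_ne_top hp hq
  have hp0 : p ≠ 0 := (one_pos.trans_le hp1.out).ne'
  have hq0 : q ≠ 0 := (one_pos.trans_le hq1.out).ne'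
  let B : E →L[ℝ] E →L[ℝ] ℝ := innerSL ℝ
  have pairing : ∀ (W : Lp E p μ) (f : Lp E q μ),
      (B.flip.lpPairing μ p q W) f = ∫ x, inner ℝ (f x) (W x) ∂μ := fun W f => by
    rw [ContinuousLinearMap.lpPairing_eq_integral]
    rfl
  have pairing_ind : ∀ (W : Lp E p μ) (A : Set α) (hA : MeasurableSet A) (c : E),
      (B.flip.lpPairing μ p q W) (indicatorConstLp q hA (measure_ne_top μ A) c)
        = ∫ x in A, inner ℝ c (W x) ∂μ := by
    intro W A hA c
    rw [pairing, ← integral_indicator hA]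
    refine integral_congr_ae ?_
    filter_upwards [indicatorConstLp_coeFn (p := q) (hs := hA) (hμs := measure_ne_top μ A) (c := c)]
      with x hx
    rw [hx]
    by_cases h : x ∈ A <;> simp [h]
  have trunc : ∀ n : ℕ, eLpNorm ({x | ‖V x‖ ≤ n}.indicator V) p μ ≤ ENNReal.ofReal ‖L‖ := by
    intro n
    set D : Set α := {x | ‖V x‖ ≤ n}
    have hD : MeasurableSet D := hVm.norm.measurable measurableSet_Iic
    set W : α → E := D.indicator V
    have hWm : StronglyMeasurable W := hVm.indicator hD
    have hWb : ∀ x, ‖W x‖ ≤ n := by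
      intro x
      by_cases h : x ∈ D
      · rw [show W x = V x from indicator_of_mem h V]
        exact h
      · simp [W, h]
    have hW : MemLp W p μ := .of_bound hWm.aestronglyMeasurable n (Filter.Eventually.of_forall hWb)
    have h1 : MemLp (D.indicator fun _ => (1 : ℝ)) ⊤ μ :=
      memLp_indicator_const ⊤ hD 1 (Or.inr (measure_ne_top _ _))
    -- Multiplication by 1_D. Pairing with the truncation W and L ∘ M are both continuous and agree
    -- on indicators, hence everywhere; this lets L be evaluated on functions that are not simple.
    let M : Lp E q μ →L[ℝ] Lp E q μ :=
      (ContinuousLinearMap.lsmul ℝ ℝ : ℝ →L[ℝ] E →L[ℝ] E).holderL μ ⊤ q q (h1.toLp _)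
    have hM : ∀ f : Lp E q μ, M f =ᵐ[μ] fun x => D.indicator (fun _ => (1 : ℝ)) x • f x := by
      intro f
      filter_upwards [(ContinuousLinearMap.lsmul ℝ ℝ : ℝ →L[ℝ] E →L[ℝ] E).coeFn_holder (r := q)
        (h1.toLp _) f, h1.coeFn_toLp] with x hx h2
      rw [← h2]
      exact hx
    have hext : B.flip.lpPairing μ p q (hW.toLp W) = L ∘L M := by
      refine continuousLinearMap_ext_indicatorConstLp hq fun A hA c => ?_
      have e : M (indicatorConstLp q hA (measure_ne_top μ A) c)
          = indicatorConstLp q (hA.inter hD) (measure_ne_top μ _) c := by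
        ext1
        filter_upwards [hM (indicatorConstLp q hA (measure_ne_top μ A) c),
          indicatorConstLp_coeFn (p := q) (hs := hA) (hμs := measure_ne_top μ A) (c := c),
          indicatorConstLp_coeFn (p := q) (hs := hA.inter hD)
            (hμs := measure_ne_top μ (A ∩ D)) (c := c)] with x h1 h2 h3
        rw [h1, h2, h3]
        by_cases hxA : x ∈ A <;> by_cases hxD : x ∈ D <;> simp [hxA, hxD]
      rw [pairing_ind, ContinuousLinearMap.comp_apply, e, hV, ← setIntegral_indicator hD]
      refine integral_congr_ae (ae_restrict_of_ae ?_)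
      filter_upwards [hW.coeFn_toLp] with x hx
      rw [hx]
      by_cases hxD : x ∈ D <;> simp [W, hxD]
    have hrp : 1 < p.toReal := hr.lt
    -- The equality case of Hölder: ⟨f, W⟩ = ‖W‖^p and ‖f‖^q = ‖W‖^p. The exponent may be negative,
    -- so zeros of W are treated apart.
    let f : α → E := fun x => ‖W x‖ ^ (p.toReal - 2) • W x
    have hfn : ∀ x, ‖f x‖ = ‖W x‖ ^ (p.toReal - 1) := by
      intro x
      rcases eq_or_ne (W x) 0 with h0 | h0
      · have : p.toReal - 1 ≠ 0 := by linarith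
        simp [f, h0, Real.zero_rpow this]
      · have hpos : 0 < ‖W x‖ := norm_pos_iff.mpr h0
        rw [norm_smul, Real.norm_of_nonneg (by positivity), ← Real.rpow_add_one hpos.ne']
        congr 1
        ring
    have hfm : StronglyMeasurable f :=
      (hWm.norm.measurable.pow_const _).stronglyMeasurable.smul hWm
    have hf : MemLp f q μ := by
      refine .of_bound hfm.aestronglyMeasurable ((n : ℝ) ^ (p.toReal - 1))
        (Filter.Eventually.of_forall fun x => ?_)
      rw [hfn]
      exact Real.rpow_le_rpow (norm_nonneg _) (hWb x) (by linarith)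
    set I : ℝ := ∫ x, ‖W x‖ ^ p.toReal ∂μ
    have hI0 : 0 ≤ I := integral_nonneg fun x => by positivity
    have hMf : M (hf.toLp f) = hf.toLp f := by
      ext1
      filter_upwards [hM (hf.toLp f), hf.coeFn_toLp] with x h1 h2
      rw [h1, h2]
      by_cases hxD : x ∈ D <;> simp [hxD, f, W]
    have hLI : L (hf.toLp f) = I := by
      rw [← hMf, ← ContinuousLinearMap.comp_apply, ← hext, pairing]
      refine integral_congr_ae ?_
      filter_upwards [hf.coeFn_toLp, hW.coeFn_toLp] with x h1 h2
      rw [h1, h2, real_inner_smul_left, real_inner_self_eq_norm_sq]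
      rcases eq_or_ne (W x) 0 with h0 | h0
      · have : p.toReal ≠ 0 := by linarith
        simp [h0, Real.zero_rpow this]
      · have hpos : 0 < ‖W x‖ := norm_pos_iff.mpr h0
        rw [← Real.rpow_natCast, ← Real.rpow_add hpos]
        congr 1
        push_cast
        ring
    have hfI : ‖hf.toLp f‖ = I ^ q.toReal⁻¹ := by
      rw [Lp.norm_toLp, hf.eLpNorm_eq_integral_rpow_norm hq0 hq,
        ENNReal.toReal_ofReal (by positivity)]
      congr 1
      refine integral_congr_ae (Filter.Eventually.of_forall fun x => ?_)
      simp only [hfn]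
      rw [← Real.rpow_mul (norm_nonneg _), hr.sub_one_mul_conj]
    have hle : I ≤ ‖L‖ * I ^ q.toReal⁻¹ := by
      rw [← hfI, ← hLI]
      exact (le_abs_self _).trans (L.le_opNorm _)
    rw [hW.eLpNorm_eq_integral_rpow_norm hp0 hp]
    refine ENNReal.ofReal_le_ofReal ?_
    change I ^ p.toReal⁻¹ ≤ ‖L‖
    -- From I ≤ ‖L‖ I^{1/q}, dividing by I^{1/q} leaves I^{1/p} ≤ ‖L‖; the division needs I > 0.
    rcases hI0.eq_or_lt with h0 | hpos
    · rw [← h0, Real.zero_rpow (inv_ne_zero hr.ne_zero)]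
      exact L.opNorm_nonneg
    · have hpos' : 0 < I ^ q.toReal⁻¹ := by positivity
      refine le_of_mul_le_mul_right ?_ hpos'
      rw [← Real.rpow_add hpos, hr.inv_add_inv_eq_one, Real.rpow_one]
      exact hle
  have hVL : eLpNorm V p μ ≤ ENNReal.ofReal ‖L‖ := by
    refine (Lp.eLpNorm_lim_le_liminf_eLpNorm (f := fun n : ℕ => {x | ‖V x‖ ≤ n}.indicator V)
      (fun n => (hVm.indicator (hVm.norm.measurable measurableSet_Iic)).aestronglyMeasurable) V
      (Filter.Eventually.of_forall fun x => ?_)).trans ?_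
    · obtain ⟨n, hn⟩ := exists_nat_ge ‖V x‖
      refine tendsto_const_nhds.congr' ?_
      filter_upwards [Filter.eventually_ge_atTop n] with m hm
      have : ‖V x‖ ≤ m := hn.trans (by exact_mod_cast hm)
      simp [this]
    · exact (Filter.liminf_le_liminf (Filter.Eventually.of_forall trunc)).trans
        (Filter.liminf_const _).le
  have hVp : MemLp V p μ := ⟨hVm.aestronglyMeasurable, hVL.trans_lt ENNReal.ofReal_lt_top⟩
  refine ⟨hVp.toLp V, fun f => ?_, ?_⟩
  · have : L = B.flip.lpPairing μ p q (hVp.toLp V) := by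
      refine continuousLinearMap_ext_indicatorConstLp hq fun A hA c => ?_
      rw [pairing_ind, hV]
      refine integral_congr_ae (ae_restrict_of_ae ?_)
      filter_upwards [hVp.coeFn_toLp] with x hx
      rw [hx]
    rw [this, pairing]
  · rw [Lp.norm_toLp]
    exact ENNReal.toReal_le_of_le_ofReal L.opNorm_nonneg hVL

/-! ### Density of gradients of functions smooth up to the boundary -/

namespace SmoothDomain

/-- The zero extension of ψu is convolved with a bump centred at -tw. For x in Ω the values used lie
within κt of x + tw, and those in the support of ψ are in Ω by `exists_transversal_direction`. Hence
on Ω the gradient is exactly the mollification of G, the zero extension of ∇(ψu), which is L^q-close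
to G for small t. -/
theorem exists_localized_gradient_approx {N : ℕ} {Ω : SmoothDomain N} {q : ℝ≥0∞}
    [hq1 : Fact (1 ≤ q)] (hq : q ≠ ⊤) (u : Ω.W1 q) {x₀ : EuclideanSpace ℝ (Fin N)}
    (hx₀ : x₀ ∈ closure Ω.carrier) :
    ∃ r : ℝ, 0 < r ∧ ∀ ψ : EuclideanSpace ℝ (Fin N) → ℝ, ContDiff ℝ ∞ ψ → HasCompactSupport ψ →
      tsupport ψ ⊆ Metric.ball x₀ r → ∀ ε : ℝ≥0∞, 0 < ε →
      ∃ φ : EuclideanSpace ℝ (Fin N) → ℝ, ContDiff ℝ ∞ φ ∧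
        eLpNorm (fun x => gradient φ x
          - (ψ x • Ω.grad q u x + (u : Lp ℝ q Ω.vol) x • gradient ψ x)) q Ω.vol ≤ ε := by
  obtain ⟨r, w, κ, δ, hr, hκ, hδ, hgeo⟩ := Ω.exists_transversal_direction hx₀
  refine ⟨r, hr, fun ψ hψ hψs hψr ε hε => ?_⟩
  have hmΩ := Ω.isOpen.measurableSet
  set u' : EuclideanSpace ℝ (Fin N) → ℝ := fun x => (u : Lp ℝ q Ω.vol) x
  set g : EuclideanSpace ℝ (Fin N) → EuclideanSpace ℝ (Fin N) := fun x => Ω.grad q u x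
  have hu : MemLp u' q Ω.vol := Lp.memLp _
  have hg : MemLp g q Ω.vol := Lp.memLp _
  have hdψc : Continuous (fderiv ℝ ψ) := hψ.continuous_fderiv (by simp)
  have hgψc : Continuous (gradient ψ) := (LinearIsometryEquiv.continuous _).comp hdψc
  obtain ⟨Cψ, hCψ⟩ := hψs.exists_bound_of_continuous hψ.continuous
  obtain ⟨Dψ, hDψ⟩ := (hψs.fderiv (𝕜 := ℝ)).exists_bound_of_continuous hdψc
  have hψtop : MemLp ψ ⊤ Ω.vol := memLp_top_of_bound hψ.continuous.aestronglyMeasurable Cψ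
    (Filter.Eventually.of_forall hCψ)
  have hgψtop : MemLp (gradient ψ) ⊤ Ω.vol := memLp_top_of_bound hgψc.aestronglyMeasurable Dψ
    (Filter.Eventually.of_forall fun z => by simpa [gradient] using hDψ z)
  set G : EuclideanSpace ℝ (Fin N) → EuclideanSpace ℝ (Fin N) :=
    Ω.carrier.indicator fun z => ψ z • g z + u' z • gradient ψ z
  have hG : MemLp G q volume :=
    (memLp_indicator_iff_restrict hmΩ).mpr ((hg.smul hψtop).add (hgψtop.smul hu))
  have hGm : StronglyMeasurable G :=
    ((hψ.continuous.stronglyMeasurable.smul (Lp.stronglyMeasurable _)).add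
      ((Lp.stronglyMeasurable (u : Lp ℝ q Ω.vol)).smul hgψc.stronglyMeasurable)).indicator hmΩ
  obtain ⟨τ, hτ, hτb⟩ := exists_eLpNorm_translate_sub_le hq hG hε
  -- Besides t < δ, the kernel's support must lie in the ball of radius τ; its points have norm at
  -- most t(‖w‖ + κ).
  obtain ⟨t, ht0, htm⟩ := exists_between (lt_min hδ (div_pos hτ (by positivity : 0 < ‖w‖ + κ)))
  have htδ : t < δ := htm.trans_le (min_le_left _ _)
  have htτ : t * (‖w‖ + κ) ≤ τ :=
    (le_div_iff₀ (by positivity)).mp (htm.le.trans (min_le_right _ _))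
  let b : ContDiffBump (-(t • w)) :=
    ⟨κ * t / 2, κ * t, by positivity, half_lt_self (by positivity)⟩
  set K : EuclideanSpace ℝ (Fin N) → ℝ := b.normed volume
  have hK : ContDiff ℝ ∞ K := b.contDiff_normed
  have hKs : HasCompactSupport K := b.hasCompactSupport_normed
  have hKt : tsupport K = Metric.closedBall (-(t • w)) (κ * t) := b.tsupport_normed_eq
  refine ⟨convolution K (Ω.carrier.indicator fun z => ψ z * u' z)
    (ContinuousLinearMap.lsmul ℝ ℝ) volume, ?_, ?_⟩
  · refine hKs.contDiff_convolution_left (n := (⊤ : ℕ∞)) _ hK ?_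
    refine Integrable.locallyIntegrable ((integrable_indicator_iff hmΩ).mpr ?_)
    exact (hu.integrable hq1.out).bdd_mul (c := Cψ) hψ.continuous.aestronglyMeasurable
      (Filter.Eventually.of_forall hCψ)
  · have hgrad : ∀ x ∈ Ω.carrier, gradient (convolution K
        (Ω.carrier.indicator fun z => ψ z * u' z) (ContinuousLinearMap.lsmul ℝ ℝ) volume) x
        = ∫ y, K y • G (x - y) := by
      intro x hx
      refine gradient_convolution_eq (hasWeakGradient_grad u) (hu.integrable hq1.out)
        (hg.integrable hq1.out) hψ hψs hK hKs x fun z hz hxz => ?_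
      rw [hKt, mem_closedBall_iff_norm] at hxz
      refine hgeo t ht0 htδ x hx z (hψr hz) ?_
      have e : x - z - -(t • w) = -(z - (x + t • w)) := by abel
      rwa [e, norm_neg] at hxz
    calc _ = eLpNorm (fun x => (∫ y, K y • G (x - y)) - G x) q Ω.vol := by
          refine eLpNorm_congr_ae ?_
          filter_upwards [ae_restrict_mem hmΩ] with x hx
          rw [hgrad x hx, show G x = _ from indicator_of_mem hx _]
      _ ≤ eLpNorm (fun x => (∫ y, K y • G (x - y)) - G x) q volume :=
          eLpNorm_mono_measure _ Measure.restrict_le_self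
      _ ≤ ε := by
          refine eLpNorm_integral_translate_sub_le hq hGm hG hK.continuous hKs
            (fun y => b.nonneg_normed y) b.integral_normed fun y hy => hτb y ?_
          have hy' : y ∈ tsupport K := subset_tsupport _ hy
          rw [hKt, mem_closedBall_iff_norm] at hy'
          calc ‖y‖ = ‖(y - -(t • w)) + -(t • w)‖ := by rw [sub_add_cancel]
            _ ≤ κ * t + t * ‖w‖ := by
              refine (norm_add_le _ _).trans (add_le_add hy' ?_)
              rw [norm_neg, norm_smul, Real.norm_of_nonneg ht0.le]
            _ ≤ τ := by linarith

theorem IsC1.coeFn_grad_toW1 {N : ℕ} {Ω : SmoothDomain N} {q : ℝ≥0∞} [Fact (1 ≤ q)]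
    {φ : EuclideanSpace ℝ (Fin N) → ℝ} (hφ : Ω.IsC1 φ) :
    Ω.grad q (hφ.toW1 q) =ᵐ[Ω.vol] gradient φ := by
  have h : Ω.grad q (hφ.toW1 q) = hφ.memLp_gradient.toLp (gradient φ) :=
    weakGradient_eq (hasWeakGradient_grad (hφ.toW1 q))
      (hφ.hasWeakGradient.congr hφ.memLp.coeFn_toLp.symm hφ.memLp_gradient.coeFn_toLp.symm)
  rw [h]
  exact hφ.memLp_gradient.coeFn_toLp

open scoped Manifold in
-- The local approximations are summed over a partition of unity f_i on the closure. On Ω the terms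
-- f_i ∇u add up to ∇u, while the terms u ∇f_i cancel because ∑ f_i is constant there.
theorem exists_isC1_grad_near {N : ℕ} {Ω : SmoothDomain N} {q : ℝ≥0∞} [hq1 : Fact (1 ≤ q)]
    (hq : q ≠ ⊤) (u : Ω.W1 q) {ε : ℝ} (hε : 0 < ε) :
    ∃ (φ : EuclideanSpace ℝ (Fin N) → ℝ) (hφ : Ω.IsC1 φ),
      ‖Ω.grad q (hφ.toW1 q) - Ω.grad q u‖ ≤ ε := by
  have hloc : ∀ x₀ : EuclideanSpace ℝ (Fin N), ∃ r : ℝ, 0 < r ∧ (x₀ ∈ closure Ω.carrier →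
      ∀ ψ : EuclideanSpace ℝ (Fin N) → ℝ, ContDiff ℝ ∞ ψ → HasCompactSupport ψ →
      tsupport ψ ⊆ Metric.ball x₀ r → ∀ ε : ℝ≥0∞, 0 < ε →
      ∃ φ : EuclideanSpace ℝ (Fin N) → ℝ, ContDiff ℝ ∞ φ ∧
        eLpNorm (fun x => gradient φ x
          - (ψ x • Ω.grad q u x + (u : Lp ℝ q Ω.vol) x • gradient ψ x)) q Ω.vol ≤ ε) := by
    intro x₀
    by_cases h : x₀ ∈ closure Ω.carrier
    · obtain ⟨r, hr, H⟩ := exists_localized_gradient_approx hq u h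
      exact ⟨r, hr, fun _ => H⟩
    · exact ⟨1, one_pos, fun h' => absurd h' h⟩
  choose r hr H using hloc
  obtain ⟨s, hs, hcov⟩ := Ω.bounded.isCompact_closure.elim_nhds_subcover
    (fun x => Metric.ball x (r x)) (fun x _ => Metric.ball_mem_nhds x (hr x))
  obtain ⟨f, hf⟩ := SmoothPartitionOfUnity.exists_isSubordinate
    (𝓘(ℝ, EuclideanSpace ℝ (Fin N))) (isClosed_closure (s := Ω.carrier))
    (fun i : s => Metric.ball (i : EuclideanSpace ℝ (Fin N)) (r i)) (fun _ => Metric.isOpen_ball)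
    (fun x hx => by
      obtain ⟨i, hi, hxi⟩ := mem_iUnion₂.mp (hcov hx)
      exact mem_iUnion.mpr ⟨⟨i, hi⟩, hxi⟩)
  have hfd : ∀ i, ContDiff ℝ ∞ (f i) := fun i => (f i).contMDiff.contDiff
  have hfs : ∀ i, HasCompactSupport (f i) := fun i =>
    Metric.isCompact_of_isClosed_isBounded (isClosed_tsupport _)
      (Metric.isBounded_ball.subset (hf i))
  have hc : 0 < ENNReal.ofReal (ε / (s.card + 1)) := ENNReal.ofReal_pos.mpr (by positivity)
  choose φ hφd hφ using fun i : s => H i (hs i i.2) (f i) (hfd i) (hfs i) (hf i) _ hc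
  have hsum : ContDiff ℝ ∞ (fun x => ∑ i, φ i x) := ContDiff.sum fun i _ => hφd i
  have hC1 : Ω.IsC1 (fun x => ∑ i, φ i x) := (hsum.of_le (by simp)).contDiffOn
  have hgsum : ∀ (F : s → EuclideanSpace ℝ (Fin N) → ℝ), (∀ i, ContDiff ℝ ∞ (F i)) → ∀ x,
      gradient (fun x => ∑ i, F i x) x = ∑ i, gradient (F i) x := by
    intro F hF x
    simp only [gradient]
    rw [fderiv_fun_sum fun i _ => (hF i).differentiable (by simp) x, map_sum]
  have hone : ∀ x ∈ Ω.carrier, ∑ i, f i x = 1 := by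
    intro x hx
    have := f.sum_eq_one (subset_closure hx)
    rwa [finsum_eq_sum_of_fintype] at this
  have hzero : ∀ x ∈ Ω.carrier, ∑ i, gradient (f i) x = 0 := by
    intro x hx
    rw [← hgsum _ hfd]
    have : (fun x => ∑ i, f i x) =ᶠ[𝓝 x] fun _ => 1 := by
      filter_upwards [Ω.isOpen.mem_nhds hx] with y hy using hone y hy
    rw [gradient, this.fderiv_eq, fderiv_fun_const]
    simp
  refine ⟨_, hC1, ?_⟩
  rw [Lp.norm_def]
  refine ENNReal.toReal_le_of_le_ofReal hε.le ?_
  calc _ = eLpNorm (∑ i, fun x => gradient (φ i) x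
          - (f i x • Ω.grad q u x + (u : Lp ℝ q Ω.vol) x • gradient (f i) x)) q Ω.vol := by
        refine eLpNorm_congr_ae ?_
        filter_upwards [Lp.coeFn_sub (Ω.grad q (hC1.toW1 q)) (Ω.grad q u),
          hC1.coeFn_grad_toW1 (q := q), ae_restrict_mem Ω.isOpen.measurableSet] with x h1 h2 hx
        rw [h1, Pi.sub_apply, h2, hgsum _ hφd, Finset.sum_apply, Finset.sum_sub_distrib,
          Finset.sum_add_distrib, ← Finset.sum_smul, ← Finset.smul_sum, hone x hx, hzero x hx,
          one_smul, smul_zero, add_zero]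
    _ ≤ ∑ i : s, eLpNorm (fun x => gradient (φ i) x
          - (f i x • Ω.grad q u x + (u : Lp ℝ q Ω.vol) x • gradient (f i) x)) q Ω.vol := by
        refine eLpNorm_sum_le (fun i _ => ?_) hq1.out
        have hgc : ∀ h : EuclideanSpace ℝ (Fin N) → ℝ, ContDiff ℝ ∞ h →
            Continuous (gradient h) := fun h hh =>
          (LinearIsometryEquiv.continuous _).comp (hh.continuous_fderiv (by simp))
        exact (hgc _ (hφd i)).aestronglyMeasurable.sub
          (((hfd i).continuous.aestronglyMeasurable.smul (Lp.aestronglyMeasurable _)).add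
            ((Lp.aestronglyMeasurable (u : Lp ℝ q Ω.vol)).smul (hgc _ (hfd i)).aestronglyMeasurable))
    _ ≤ ∑ i : s, ENNReal.ofReal (ε / (s.card + 1)) := Finset.sum_le_sum fun i _ => hφ i
    _ ≤ ENNReal.ofReal ε := by
        rw [← ENNReal.ofReal_sum_of_nonneg (fun _ _ => by positivity)]
        refine ENNReal.ofReal_le_ofReal ?_
        rw [Finset.sum_const, Finset.card_univ, Fintype.card_coe, nsmul_eq_mul, ← mul_div_assoc,
          div_le_iff₀ (by positivity)]
        linarith

end SmoothDomain

/-! ### Duality: the lower bound and its attainment -/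

theorem abs_integral_inner_le {α E : Type*} [MeasurableSpace α] {μ : Measure α}
    [NormedAddCommGroup E] [InnerProductSpace ℝ E] {p q : ℝ≥0∞} [Fact (1 ≤ p)] [Fact (1 ≤ q)]
    [ENNReal.HolderConjugate q p] (f : Lp E q μ) (V : Lp E p μ) :
    |∫ x, inner ℝ (f x) (V x) ∂μ| ≤ ‖f‖ * ‖V‖ := by
  let B : E →L[ℝ] E →L[ℝ] ℝ := innerSL ℝ
  have hB : ‖B‖ ≤ 1 := norm_innerSL_le ℝ
  have e : ∫ x, inner ℝ (f x) (V x) ∂μ = L1.integral (B.holder 1 f V) := by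
    rw [L1.integral_eq_integral]
    exact integral_congr_ae (B.coeFn_holder f V).symm
  rw [e]
  calc _ ≤ ‖B.holder 1 f V‖ := L1.norm_integral_le _
    _ ≤ ‖B‖ * ‖f‖ * ‖V‖ := B.norm_holder_apply_apply_le f V
    _ ≤ 1 * ‖f‖ * ‖V‖ := by gcongr
    _ = ‖f‖ * ‖V‖ := by rw [one_mul]

namespace SmoothDomain

/-- Homogeneity reduces to unit vectors, and vectors of seminorm zero are killed by continuity. If
there are no unit vectors, `sSup ∅ = 0` still agrees with ‖T‖. -/
theorem dualNorm_eq_norm {N : ℕ} {Ω : SmoothDomain N} {q : ℝ≥0∞} [Fact (1 ≤ q)]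
    (T : Ω.DotWDual q) : dualNorm T = ‖T‖ := by
  set S : Set ℝ := {r : ℝ | ∃ φ : Ω.DotW q, ‖φ‖ = 1 ∧ T φ = r}
  have hle : ∀ r ∈ S, r ≤ ‖T‖ := by
    rintro r ⟨φ, h1, rfl⟩
    have := (le_abs_self _).trans (T.le_opNorm φ)
    rwa [h1, mul_one] at this
  have hbdd : BddAbove S := ⟨_, hle⟩
  have habs : ∀ φ : Ω.DotW q, ‖φ‖ = 1 → |T φ| ≤ sSup S := by
    intro φ h1
    refine abs_le'.mpr ⟨le_csSup hbdd ⟨φ, h1, rfl⟩, le_csSup hbdd ⟨-φ, by rwa [norm_neg], ?_⟩⟩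
    rw [map_neg]
  have h0 : 0 ≤ sSup S := by
    rcases S.eq_empty_or_nonempty with h | ⟨r, φ, h1, -⟩
    · rw [h, Real.sSup_empty]
    · exact (abs_nonneg _).trans (habs φ h1)
  refine le_antisymm (Real.sSup_le hle (norm_nonneg _)) (T.opNorm_le_bound h0 fun φ => ?_)
  rcases eq_or_ne ‖φ‖ 0 with h | h
  · have := T.le_opNorm φ
    rw [h, mul_zero] at this ⊢
    exact this
  · have := habs (‖φ‖⁻¹ • φ) (by rw [norm_smul, norm_inv, norm_norm, inv_mul_cancel₀ h])
    rw [map_smul, smul_eq_mul, abs_mul, abs_inv, abs_norm] at this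
    have hpos : 0 < ‖φ‖ := lt_of_le_of_ne (norm_nonneg _) h.symm
    rwa [inv_mul_le_iff₀ hpos, mul_comm] at this

/-- Hölder bounds T on classes of C¹ functions; density of their gradients and continuity of T carry
the bound to every class. -/
theorem SolvesNeumann.norm_le {N : ℕ} {Ω : SmoothDomain N} {p q : ℝ≥0∞} [Fact (1 ≤ p)]
    [Fact (1 ≤ q)] [ENNReal.HolderConjugate q p] (hq : q ≠ ⊤) {T : Ω.DotWDual q}
    {V : Lp (EuclideanSpace ℝ (Fin N)) p Ω.vol} (h : SolvesNeumann V T) : ‖T‖ ≤ ‖V‖ := by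
  refine T.opNorm_le_bound (norm_nonneg _) fun Φ => ?_
  obtain ⟨u, rfl⟩ : ∃ u, DotW.mk Ω q u = Φ := (Ω.constants q).mkQ_surjective Φ
  refine le_of_forall_pos_le_add fun η hη => ?_
  set ε : ℝ := η / (‖V‖ + ‖T‖ + 1)
  have hVn : 0 ≤ ‖V‖ := norm_nonneg _
  have hε : 0 < ε := by positivity
  obtain ⟨φ, hφ, hnear⟩ := exists_isC1_grad_near hq u hε
  set v := hφ.toW1 q
  have hsub : ‖DotW.mk Ω q v - DotW.mk Ω q u‖ ≤ ε := by
    rw [← map_sub, DotW.norm_mk, map_sub]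
    exact hnear
  have hv : |T (DotW.mk Ω q v)| ≤ ‖DotW.mk Ω q v‖ * ‖V‖ := by
    rw [← h φ hφ]
    have e : ∫ x in Ω.carrier, inner ℝ (gradient φ x) (V x)
        = ∫ x, inner ℝ (Ω.grad q v x) (V x) ∂Ω.vol :=
      integral_congr_ae (by
        filter_upwards [hφ.coeFn_grad_toW1 (q := q)] with x hx
        rw [hx])
    rw [e]
    exact abs_integral_inner_le _ _
  have hvn : ‖DotW.mk Ω q v‖ ≤ ‖DotW.mk Ω q u‖ + ε := by
    calc _ = ‖(DotW.mk Ω q v - DotW.mk Ω q u) + DotW.mk Ω q u‖ := by rw [sub_add_cancel]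
      _ ≤ _ := (norm_add_le _ _).trans (by linarith)
  have hT : ‖T (DotW.mk Ω q v - DotW.mk Ω q u)‖ ≤ ‖T‖ * ε :=
    (T.le_opNorm _).trans (by gcongr)
  have hη' : (‖V‖ + ‖T‖) * ε ≤ η := by
    have : (‖V‖ + ‖T‖ + 1) * ε = η := mul_div_cancel₀ _ (by positivity)
    linarith
  calc ‖T (DotW.mk Ω q u)‖
      = ‖T (DotW.mk Ω q v) - T (DotW.mk Ω q v - DotW.mk Ω q u)‖ := by
        rw [map_sub, sub_sub_cancel]
    _ ≤ ‖DotW.mk Ω q v‖ * ‖V‖ + ‖T‖ * ε := (norm_sub_le _ _).trans (add_le_add hv hT)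
    _ ≤ (‖DotW.mk Ω q u‖ + ε) * ‖V‖ + ‖T‖ * ε := by gcongr
    _ = ‖V‖ * ‖DotW.mk Ω q u‖ + (‖V‖ + ‖T‖) * ε := by ring
    _ ≤ ‖V‖ * ‖DotW.mk Ω q u‖ + η := by gcongr

/-- T is transported to the range of the gradient, extended by Hahn–Banach, and represented by a
field. -/
theorem exists_solvesNeumann_norm_le {N : ℕ} {Ω : SmoothDomain N} {p q : ℝ≥0∞}
    [Fact (1 ≤ p)] [Fact (1 ≤ q)] [ENNReal.HolderConjugate p q] (hp : p ≠ ⊤) (hq : q ≠ ⊤)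
    (T : Ω.DotWDual q) :
    ∃ V : Lp (EuclideanSpace ℝ (Fin N)) p Ω.vol, SolvesNeumann V T ∧ ‖V‖ ≤ ‖T‖ := by
  let D := DotW.grad Ω q
  have hD : ∀ φ, ‖D φ‖ = ‖φ‖ := fun _ => rfl
  -- A merely algebraic linear section suffices: D preserves the seminorm, so T ∘ s is bounded by
  -- ‖T‖.
  obtain ⟨s, hs⟩ := D.rangeRestrict.exists_rightInverse_of_surjective D.range_rangeRestrict
  have hDs : ∀ y : LinearMap.range D, D (s y) = y := fun y =>
    congrArg Subtype.val (LinearMap.congr_fun hs y)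
  let l : StrongDual ℝ (LinearMap.range D) :=
    ((T : Ω.DotW q →ₗ[ℝ] ℝ) ∘ₗ s).mkContinuous ‖T‖ fun y => by
      have := T.le_opNorm (s y)
      rwa [← hD, hDs] at this
  have hl : ∀ φ, l ⟨D φ, φ, rfl⟩ = T φ := by
    intro φ
    -- The choice of section does not matter: s(Dφ) - φ has zero seminorm, hence T kills it.
    -- Injectivity of D is not needed.
    have h0 : ‖s ⟨D φ, φ, rfl⟩ - φ‖ = 0 := by
      rw [← hD, map_sub, hDs, sub_self, norm_zero]
    have h1 := T.le_opNorm (s ⟨D φ, φ, rfl⟩ - φ)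
    rw [h0, mul_zero, map_sub] at h1
    exact sub_eq_zero.mp (norm_le_zero_iff.mp h1)
  obtain ⟨L, hL, hLn⟩ := exists_extension_norm_eq _ l
  obtain ⟨V, hV, hVn⟩ := exists_Lp_density_of_dual_Lp (p := p) hp hq L
  refine ⟨V, fun φ hφ => ?_, hVn.trans (hLn.le.trans
    (LinearMap.mkContinuous_norm_le _ (norm_nonneg _) _))⟩
  rw [← hl, ← hL, hV]
  refine integral_congr_ae ?_
  filter_upwards [hφ.coeFn_grad_toW1 (q := q)] with x hx
  rw [← hx]
  rfl

end SmoothDomain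

theorem corollary3p2 {N : ℕ} (Ω : SmoothDomain N) {p q : ℝ≥0∞} [Fact (1 ≤ q)]
    (hq : 1 < q) (hq' : q < ⊤) (hpq : ENNReal.HolderConjugate p q) (T : Ω.DotWDual q) :
    IsLeast
      {r : ℝ | ∃ V : Lp (EuclideanSpace ℝ (Fin N)) p Ω.vol,
        SmoothDomain.SolvesNeumann V T ∧ ‖V‖ = r}
      (SmoothDomain.dualNorm T) := by
  have hqp : ENNReal.HolderConjugate q p := hpq.symm
  have hp : p ≠ ⊤ := by
    rintro rfl
    exact hq.ne' (ENNReal.HolderConjugate.unique ⊤ q 1)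
  have : Fact (1 ≤ p) := ⟨ENNReal.HolderConjugate.one_le p q⟩
  rw [SmoothDomain.dualNorm_eq_norm]
  refine ⟨?_, ?_⟩
  · obtain ⟨V, hV, hle⟩ := SmoothDomain.exists_solvesNeumann_norm_le hp hq'.ne T
    exact ⟨V, hV, le_antisymm hle (hV.norm_le hq'.ne)⟩
  · rintro r ⟨V, hV, rfl⟩
    exact hV.norm_le hq'.ne
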